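/- Let $X_1,X_2,\dots$ be i.i.d. random variables with $X_1\ge 0$, and let $N$ be a random variable with values in $\{1,2,3,\dots\}$ that is independent of the sequence $(X_k)$. Write $X=X_1$ and $S_N=\sum_{k=1}^N X_k$. Assume that $X$ and $N$ are heavy-tailed, that is, $E(e^{sX})=E(e^{sN})=\infty$ for every $s>0$. For a heavy-tailed random variable $Y\ge 0$ let $\mathcal I(Y)$ be the set of its natural scales: the concave functions $h\colon[0,\infty)\to[0,\infty)$ with $h(0)=0$, $h(x)\to\infty$ as $x\to\infty$, and $\liminf_{x\to\infty} \frac{-\log P(Y>x)}{h(x)}=1$. Suppose that at least one of the following two conditions holds. 1. There is $h_X\in\mathcal I(X)$ such that $\liminf_{x\to\infty} \frac{h_X(x)}{\sqrt x}\in(0,\infty]$ and $\liminf_{x\to\infty} \frac{h_N(c_1x)}{h_X(x)}\in(0,\infty]$ for some $h_N\in\mathcal I(N)$ and some $c_1>E(X)$. 2. There is $h_N\in\mathcal I(N)$ such that $\liminf_{x\to\infty} \frac{h_N(E(X)x)}{\sqrt x}\in(0,\infty]$ and $\liminf_{x\to\infty} \frac{h_X(x)}{h_N(E(X)x)}\in(0,\infty]$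 for some $h_X\in\mathcal I(X)$. (In particular, $E(X)<\infty$.) Then $S_N$ is determined by its moments in the sense of Stieltjes: all moments $E(S_N^k)$, $k\in\mathbb N$, are finite, and every non-negative random variable $Y$ with $E(Y^k)=E(S_N^k)$ for all $k\in\mathbb N$ has the same law as $S_N$. -/

import Mathlib

open MeasureTheory ProbabilityTheory Filter

noncomputable section

namespace StoppedSum

variable {Ω : Type*} [MeasurableSpace Ω]

/-- A real random variable `Y` is (right) heavy-tailed if `E (exp (s Y)) = ∞` for all `s > 0`. -/
def HeavyTailed (Y : Ω → ℝ) (μ : Measure Ω) : Prop :=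
  ∀ s : ℝ, 0 < s → ∫⁻ ω, ENNReal.ofReal (Real.exp (s * Y ω)) ∂μ = ⊤

/-- The hazard function `R_Y x = - log P (Y > x)`, with the convention `- log 0 = ∞`. -/
def hazard (Y : Ω → ℝ) (μ : Measure Ω) (x : ℝ) : EReal :=
  -ENNReal.log (μ {ω | x < Y ω})

/-- The class `𝓘 (Y)` of natural scales of `Y`: concave functions `h : [0, ∞) → [0, ∞)` with
`h 0 = 0`, `h x → ∞` as `x → ∞` and `liminf_{x → ∞} R_Y x / h x = 1`. A function on `[0, ∞)` is
represented by a function on `ℝ` whose values at negative points play no role. -/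
def naturalScales (Y : Ω → ℝ) (μ : Measure Ω) : Set (ℝ → ℝ) :=
  {h | ConcaveOn ℝ (Set.Ici 0) h ∧ (∀ x, 0 ≤ x → 0 ≤ h x) ∧ h 0 = 0 ∧
    Tendsto h atTop atTop ∧
    liminf (fun x : ℝ => hazard Y μ x / (h x : EReal)) atTop = 1}

/-- The limit inferior at `+∞` of a real function, as an extended real number. -/
def liminfAtTop (f : ℝ → ℝ) : EReal :=
  liminf (fun x : ℝ => (f x : EReal)) atTop

/-- The randomly stopped sum `S_N = X_1 + ... + X_N` (the increments are `X 0, X 1, ...`). -/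
def stoppedSum (X : ℕ → Ω → ℝ) (N : Ω → ℕ) (ω : Ω) : ℝ :=
  ∑ k ∈ Finset.range (N ω), X k ω

/-- A non-negative random variable `Y` is determined by its moments in the sense of Stieltjes:
all its moments are finite, and every probability law `ν` on `[0, ∞)` with the same moments is
the law of `Y`. -/
def StieltjesDeterminate (Y : Ω → ℝ) (μ : Measure Ω) : Prop :=
  (∀ᵐ ω ∂μ, 0 ≤ Y ω) ∧
  (∀ k : ℕ, Integrable (fun ω => Y ω ^ k) μ) ∧
  ∀ ν : Measure ℝ, IsProbabilityMeasure ν → (∀ᵐ y ∂ν, 0 ≤ y) →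
    (∀ k : ℕ, Integrable (fun y : ℝ => y ^ k) ν ∧ ∫ y, y ^ k ∂ν = ∫ ω, Y ω ^ k ∂μ) →
    ν = μ.map Y

end StoppedSum

end

/-! Either condition forces `P(X > x)` and `P(N > x)` to be `O(exp (-a √x))` for some `a > 0`, and
this is all that is used of the natural scales. Such tails pass to `S_N` and imply Stieltjes
determinacy.

Tail of `S_N` (`SqrtExpTail.stoppedSum`): take `M` of order `x`. If `S_N > x`, then `N > M`, or one
of the first `M` increments exceeds `x`, or the sum of `M` increments truncated at `x` reaches `x`.
The first two events are controlled by the tails of `N` and `X`. The third is controlled by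
Chernoff's bound with parameter `η / √x`: since `min y x ≤ √x √y`, the truncated exponential moment
is at most `1 + (η / √x) E(X exp (η √X))`, so a small enough ratio `M / x` leaves a factor `exp (-c
√x)`.

Determinacy (Hardy's criterion): the symmetrised law of `√Y` has moment generating function
proportional to `E cosh (t √Y) = ∑ t^(2k) E(Y^k) / (2k)!`. It depends only on the moments of `Y` and
is finite near `0`, so it identifies the law. -/

namespace StoppedSum

/-! ### Square-root exponential tails and exponential moments of the square root. -/

section StretchedExponentialTail

variable {Ω : Type*} [MeasurableSpace Ω] {μ : Measure Ω} {Y : Ω → ℝ}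

/-- The tail of `Y` decays at least as fast as `exp (-a √x)` for some `a > 0`. -/
def SqrtExpTail (Y : Ω → ℝ) (μ : Measure Ω) : Prop :=
  ∃ C a : ℝ, 0 < a ∧ ∀ x, 0 ≤ x → μ.real {ω | x < Y ω} ≤ C * Real.exp (-a * √x)

lemma SqrtExpTail.of_eventually [IsProbabilityMeasure μ] {C a : ℝ} (ha : 0 < a)
    (h : ∀ᶠ x in atTop, μ.real {ω | x < Y ω} ≤ C * Real.exp (-a * √x)) : SqrtExpTail Y μ := by
  obtain ⟨x₀, hx₀⟩ := eventually_atTop.1 h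
  refine ⟨max C (Real.exp (a * √x₀)), a, ha, fun x _ => ?_⟩
  rcases le_total x₀ x with hx | hx
  · exact (hx₀ x hx).trans (by gcongr; exact le_max_left _ _)
  · calc μ.real {ω | x < Y ω} ≤ 1 := measureReal_le_one
      _ ≤ Real.exp (a * √x₀) * Real.exp (-a * √x) := by
        rw [← Real.exp_add, Real.one_le_exp_iff]
        nlinarith [Real.sqrt_le_sqrt hx]
      _ ≤ _ := by gcongr; exact le_max_right _ _

lemma le_mul_exp_sqrt {a x : ℝ} (ha : 0 < a) (hx : 0 ≤ x) :
    x ≤ 2 / a ^ 2 * Real.exp (a * √x) := by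
  have h := Real.pow_div_factorial_le_exp (x := a * √x) (by positivity) 2
  rw [mul_pow, Real.sq_sqrt hx] at h
  rw [div_mul_eq_mul_div, le_div_iff₀ (by positivity)]
  simp only [Nat.factorial] at h
  norm_num at h
  linarith

/-- Discrete layer-cake bound: for `y > 0` the single term with `n < √y ≤ n + 1` already dominates;
the summand `1` covers `y ≤ 0`. -/
lemma exp_sqrt_le_tsum {ε y : ℝ} (hε : 0 ≤ ε) :
    ENNReal.ofReal (Real.exp (ε * √y)) ≤
      1 + ∑' n : ℕ, (if (n : ℝ) ^ 2 < y then ENNReal.ofReal (Real.exp (ε * (n + 1))) else 0) := by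
  rcases le_or_gt y 0 with hy | hy
  · simp [Real.sqrt_eq_zero_of_nonpos hy]
  have hs : 0 < √y := Real.sqrt_pos.2 hy
  obtain ⟨n, hn⟩ : ∃ n : ℕ, ⌈√y⌉₊ = n + 1 := Nat.exists_eq_succ_of_ne_zero (Nat.ceil_pos.2 hs).ne'
  have h1 : √y ≤ n + 1 := by have := Nat.le_ceil √y; rw [hn] at this; exact_mod_cast this
  have h2 : (n : ℝ) < √y := Nat.lt_ceil.1 (by omega)
  have h3 : (n : ℝ) ^ 2 < y := by rwa [Real.lt_sqrt (by positivity)] at h2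
  refine le_add_left (le_trans ?_ (ENNReal.le_tsum n))
  rw [if_pos h3]
  gcongr

lemma SqrtExpTail.exists_lintegral_exp_lt_top [IsProbabilityMeasure μ] (hY : Measurable Y)
    (h : SqrtExpTail Y μ) :
    ∃ ε : ℝ, 0 < ε ∧ ∫⁻ ω, ENNReal.ofReal (Real.exp (ε * √(Y ω))) ∂μ < ⊤ := by
  obtain ⟨C, a, ha, h⟩ := h
  -- Half the decay rate leaves `exp (a / 2 * (n + 1)) * exp (-a * n)`, a geometric sequence.
  refine ⟨a / 2, by positivity, ?_⟩
  have hms : ∀ n : ℕ, MeasurableSet {ω | (n : ℝ) ^ 2 < Y ω} :=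
    fun n => measurableSet_lt measurable_const hY
  have hterm : ∀ n : ℕ, ∫⁻ ω, (if (n : ℝ) ^ 2 < Y ω then
      ENNReal.ofReal (Real.exp (a / 2 * (n + 1))) else 0) ∂μ ≤
      ENNReal.ofReal (C * Real.exp (a / 2) * Real.exp (-(a / 2)) ^ n) := by
    intro n
    have : ∀ ω, (if (n : ℝ) ^ 2 < Y ω then ENNReal.ofReal (Real.exp (a / 2 * (n + 1))) else 0) =
        Set.indicator {ω | (n : ℝ) ^ 2 < Y ω}
          (fun _ => ENNReal.ofReal (Real.exp (a / 2 * (n + 1)))) ω := by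
      intro ω; simp [Set.indicator]
    simp_rw [this]
    rw [lintegral_indicator_const (hms n), ← ofReal_measureReal, ← ENNReal.ofReal_mul (by positivity)]
    apply ENNReal.ofReal_le_ofReal
    have h1 := h ((n : ℝ) ^ 2) (by positivity)
    rw [Real.sqrt_sq (by positivity)] at h1
    calc _ ≤ Real.exp (a / 2 * (n + 1)) * (C * Real.exp (-a * n)) := by gcongr
      _ = C * (Real.exp (a / 2 * (n + 1)) * Real.exp (-a * n)) := by ring
      _ = C * (Real.exp (a / 2) * Real.exp (-(a / 2)) ^ n) := by
        rw [← Real.exp_nat_mul, ← Real.exp_add, ← Real.exp_add]; ring_nf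
      _ = _ := by ring
  have hsum : Summable fun n : ℕ => C * Real.exp (a / 2) * Real.exp (-(a / 2)) ^ n :=
    (summable_geometric_of_lt_one (Real.exp_pos _).le
      (Real.exp_lt_one_iff.2 (by linarith))).mul_left _
  calc ∫⁻ ω, ENNReal.ofReal (Real.exp (a / 2 * √(Y ω))) ∂μ
      ≤ ∫⁻ ω, (1 + ∑' n : ℕ, (if (n : ℝ) ^ 2 < Y ω then
          ENNReal.ofReal (Real.exp (a / 2 * (n + 1))) else 0)) ∂μ :=
        lintegral_mono fun ω => exp_sqrt_le_tsum (by positivity)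
    _ = 1 + ∑' n : ℕ, ∫⁻ ω, (if (n : ℝ) ^ 2 < Y ω then
          ENNReal.ofReal (Real.exp (a / 2 * (n + 1))) else 0) ∂μ := by
        rw [lintegral_add_left measurable_const, lintegral_tsum]
        · simp
        · exact fun n => (Measurable.ite (hms n) measurable_const measurable_const).aemeasurable
    _ ≤ 1 + ∑' n : ℕ, ENNReal.ofReal (C * Real.exp (a / 2) * Real.exp (-(a / 2)) ^ n) := by
        gcongr with n
        exact hterm n
    _ < ⊤ := ENNReal.add_lt_top.2 ⟨ENNReal.one_lt_top, hsum.tsum_ofReal_lt_top⟩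

end StretchedExponentialTail

/-! ### Hardy's criterion for Stieltjes determinacy. -/

section MomentDeterminacy

/-- A finite measure on `ℝ` with exponential moments near `0` is determined by its moment
generating function. -/
lemma ext_of_mgf_id_eq {μ ν : Measure ℝ} [IsFiniteMeasure μ] [IsFiniteMeasure ν]
    (h : mgf id μ = mgf id ν) (hzero : μ = 0 ↔ ν = 0)
    (h0 : 0 ∈ interior (integrableExpSet id μ)) : μ = ν := by
  refine Measure.ext_of_charFun (funext fun t => ?_)
  rw [← complexMGF_id_mul_I, ← complexMGF_id_mul_I]
  exact eqOn_complexMGF_of_mgf' h hzero (by simpa using h0)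

/-- The image of `ν` under `√`, symmetrised. -/
noncomputable def sqrtSymm (ν : Measure ℝ) : Measure ℝ := ν.map Real.sqrt + ν.map (fun y => -√y)

instance (ν : Measure ℝ) [IsFiniteMeasure ν] : IsFiniteMeasure (sqrtSymm ν) := by
  unfold sqrtSymm; infer_instance

lemma lintegral_exp_sqrtSymm {ν : Measure ℝ} (t : ℝ) :
    ∫⁻ x, ENNReal.ofReal (Real.exp (t * x)) ∂(sqrtSymm ν) =
      ∫⁻ y, ENNReal.ofReal (2 * Real.cosh (t * √y)) ∂ν := by
  rw [sqrtSymm, lintegral_add_measure, lintegral_map (by fun_prop) (by fun_prop),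
    lintegral_map (by fun_prop) (by fun_prop), ← lintegral_add_left (by fun_prop)]
  refine lintegral_congr fun y => ?_
  rw [← ENNReal.ofReal_add (by positivity) (by positivity), Real.cosh_eq]
  congr 1
  ring_nf

/-- Symmetrisation keeps only even powers, and `√y ^ (2 * k) = y ^ k`. By Tonelli the identity holds
in `[0, ∞]`, so no exponential moment of `ν` has to be known beforehand. -/
lemma lintegral_exp_sqrtSymm_eq_tsum {ν : Measure ℝ} (hν : ∀ᵐ y ∂ν, 0 ≤ y)
    (hint : ∀ k : ℕ, Integrable (fun y : ℝ => y ^ k) ν) (t : ℝ) :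
    ∫⁻ x, ENNReal.ofReal (Real.exp (t * x)) ∂(sqrtSymm ν) =
      ∑' k : ℕ, ENNReal.ofReal (2 * (t ^ (2 * k) / (2 * k).factorial)) *
        ENNReal.ofReal (∫ y, y ^ k ∂ν) := by
  have ht : ∀ k : ℕ, 0 ≤ t ^ (2 * k) := fun k => (even_two_mul k).pow_nonneg t
  rw [lintegral_exp_sqrtSymm]
  have h1 : ∀ᵐ y ∂ν, ENNReal.ofReal (2 * Real.cosh (t * √y)) =
      ∑' k : ℕ, ENNReal.ofReal (2 * (t ^ (2 * k) / (2 * k).factorial)) *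
        ENNReal.ofReal (y ^ k) := by
    filter_upwards [hν] with y hy
    have hs := (Real.hasSum_cosh (t * √y)).mul_left 2
    rw [← hs.tsum_eq, ENNReal.ofReal_tsum_of_nonneg _ hs.summable]
    · refine tsum_congr fun k => ?_
      rw [← ENNReal.ofReal_mul (by have := ht k; positivity), mul_pow, pow_mul √y,
        Real.sq_sqrt hy]
      congr 1
      ring
    · intro k
      have := (even_two_mul k).pow_nonneg (t * √y)
      positivity
  rw [lintegral_congr_ae h1, lintegral_tsum (fun k => by fun_prop)]
  refine tsum_congr fun k => ?_
  rw [lintegral_const_mul _ (by fun_prop), ofReal_integral_eq_lintegral_ofReal (hint k)]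
  filter_upwards [hν] with y hy using pow_nonneg hy k

lemma map_sq_sqrtSymm {ν : Measure ℝ} (hν : ∀ᵐ y ∂ν, 0 ≤ y) :
    (sqrtSymm ν).map (fun x => x ^ 2) = ν + ν := by
  have h : (fun y => √y ^ 2) =ᵐ[ν] id := by
    filter_upwards [hν] with y hy using Real.sq_sqrt hy
  rw [sqrtSymm, Measure.map_add _ _ (by fun_prop), Measure.map_map (by fun_prop) (by fun_prop),
    Measure.map_map (by fun_prop) (by fun_prop)]
  simp only [Function.comp_def, neg_sq]
  rw [Measure.map_congr h, Measure.map_id]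

/-- **Hardy's criterion**: a law on `[0, ∞)` for which `exp (c √y)` is integrable for some `c > 0`
is determined by its moments among all laws on `[0, ∞)`. -/
lemma eq_of_moments_eq_of_lintegral_exp_sqrt_lt_top {ν ρ : Measure ℝ} [IsProbabilityMeasure ν]
    [IsProbabilityMeasure ρ] (hν : ∀ᵐ y ∂ν, 0 ≤ y) (hρ : ∀ᵐ y ∂ρ, 0 ≤ y)
    (hνi : ∀ k : ℕ, Integrable (fun y : ℝ => y ^ k) ν)
    (hρi : ∀ k : ℕ, Integrable (fun y : ℝ => y ^ k) ρ)
    (hmom : ∀ k : ℕ, ∫ y, y ^ k ∂ν = ∫ y, y ^ k ∂ρ) {c : ℝ} (hc : 0 < c)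
    (hexp : ∫⁻ y, ENNReal.ofReal (Real.exp (c * √y)) ∂ρ < ⊤) : ν = ρ := by
  have hne : ∀ (κ : Measure ℝ) [IsProbabilityMeasure κ], sqrtSymm κ ≠ 0 := by
    intro κ _ h
    have h2 : κ.map Real.sqrt Set.univ + κ.map (fun y => -√y) Set.univ = 0 := by
      rw [← Measure.add_apply]; change sqrtSymm κ _ = 0; simp [h]
    rw [Measure.map_apply (by fun_prop) .univ] at h2
    simp at h2
  have hlin : ∀ t : ℝ, ∫⁻ x, ENNReal.ofReal (Real.exp (t * x)) ∂(sqrtSymm ρ) =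
      ∫⁻ x, ENNReal.ofReal (Real.exp (t * x)) ∂(sqrtSymm ν) := fun t => by
    rw [lintegral_exp_sqrtSymm_eq_tsum hν hνi, lintegral_exp_sqrtSymm_eq_tsum hρ hρi]
    simp_rw [hmom]
  have hmgf : mgf id (sqrtSymm ρ) = mgf id (sqrtSymm ν) := funext fun t => by
    simp only [mgf, id]
    rw [integral_eq_lintegral_of_nonneg_ae (ae_of_all _ fun _ => (Real.exp_pos _).le)
        (by fun_prop), integral_eq_lintegral_of_nonneg_ae
        (ae_of_all _ fun _ => (Real.exp_pos _).le) (by fun_prop), hlin]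
  -- Finiteness is checked for `ρ` only; equality of the generating functions carries the rest.
  have hsub : Set.Icc (-c) c ⊆ integrableExpSet id (sqrtSymm ρ) := by
    intro t ht
    refine ⟨by fun_prop, ?_⟩
    rw [hasFiniteIntegral_iff_ofReal (ae_of_all _ fun _ => (Real.exp_pos _).le)]
    simp only [id]
    rw [lintegral_exp_sqrtSymm]
    calc ∫⁻ y, ENNReal.ofReal (2 * Real.cosh (t * √y)) ∂ρ
        ≤ ∫⁻ y, 2 * ENNReal.ofReal (Real.exp (c * √y)) ∂ρ := by
          refine lintegral_mono fun y => ?_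
          rw [← ENNReal.ofReal_ofNat 2, ← ENNReal.ofReal_mul (by norm_num)]
          apply ENNReal.ofReal_le_ofReal
          have h1 : Real.exp (t * √y) ≤ Real.exp (c * √y) := by gcongr; exact ht.2
          have h2 : Real.exp (-(t * √y)) ≤ Real.exp (c * √y) := by
            rw [← neg_mul]; gcongr; linarith [ht.1]
          rw [Real.cosh_eq]
          linarith
      _ = 2 * ∫⁻ y, ENNReal.ofReal (Real.exp (c * √y)) ∂ρ :=
          lintegral_const_mul _ (by fun_prop)
      _ < ⊤ := ENNReal.mul_lt_top (by simp) hexp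
  have h0 : 0 ∈ interior (integrableExpSet id (sqrtSymm ρ)) :=
    interior_mono hsub (by rw [interior_Icc]; exact ⟨by linarith, hc⟩)
  have heq : sqrtSymm ρ = sqrtSymm ν :=
    ext_of_mgf_id_eq hmgf (by simp [hne]) h0
  have h2 : ν + ν = ρ + ρ := by rw [← map_sq_sqrtSymm hν, ← map_sq_sqrtSymm hρ, heq]
  ext s _
  have h3 : ν s + ν s = ρ s + ρ s := by rw [← Measure.add_apply, h2, Measure.add_apply]
  rw [← two_mul, ← two_mul] at h3
  exact (ENNReal.mul_right_inj (by simp) (by simp)).1 h3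

variable {Ω : Type*} [MeasurableSpace Ω] {μ : Measure Ω} {Y : Ω → ℝ}

lemma integrable_pow_of_lintegral_exp_sqrt_lt_top (hY : Measurable Y) (hY0 : ∀ᵐ ω ∂μ, 0 ≤ Y ω)
    {c : ℝ} (hc : 0 < c) (hexp : ∫⁻ ω, ENNReal.ofReal (Real.exp (c * √(Y ω))) ∂μ < ⊤) (k : ℕ) :
    Integrable (fun ω => Y ω ^ k) μ := by
  have hi : Integrable (fun ω => Real.exp (c * √(Y ω))) μ := by
    refine ⟨by fun_prop, ?_⟩
    rwa [hasFiniteIntegral_iff_ofReal (ae_of_all _ fun _ => (Real.exp_pos _).le)]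
  refine (hi.const_mul ((2 * k).factorial / c ^ (2 * k))).mono' (by fun_prop) ?_
  filter_upwards [hY0] with ω hω
  rw [Real.norm_of_nonneg (by positivity), div_mul_eq_mul_div, le_div_iff₀ (by positivity)]
  have h := Real.pow_div_factorial_le_exp (x := c * √(Y ω)) (by positivity) (2 * k)
  rw [mul_pow, pow_mul √(Y ω), Real.sq_sqrt hω, div_le_iff₀ (by positivity)] at h
  linarith

lemma SqrtExpTail.stieltjesDeterminate [IsProbabilityMeasure μ] (hY : Measurable Y)
    (hY0 : ∀ᵐ ω ∂μ, 0 ≤ Y ω) (h : SqrtExpTail Y μ) : StieltjesDeterminate Y μ := by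
  obtain ⟨c, hc, hexp⟩ := h.exists_lintegral_exp_lt_top hY
  have hint := integrable_pow_of_lintegral_exp_sqrt_lt_top hY hY0 hc hexp
  refine ⟨hY0, hint, fun ν _ hν hmom => ?_⟩
  have : IsProbabilityMeasure (μ.map Y) := Measure.isProbabilityMeasure_map hY.aemeasurable
  refine eq_of_moments_eq_of_lintegral_exp_sqrt_lt_top hν
    ((ae_map_iff hY.aemeasurable measurableSet_Ici).2 hY0) (fun k => (hmom k).1)
    (fun k => (integrable_map_measure (by fun_prop) hY.aemeasurable).2 (hint k))
    (fun k => ?_) hc ?_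
  · rw [(hmom k).2, integral_map hY.aemeasurable (by fun_prop)]
  · rwa [lintegral_map (by fun_prop) hY]

end MomentDeterminacy

/-! ### Tail of the randomly stopped sum. -/

section StoppedSumTail

variable {Ω : Type*} [MeasurableSpace Ω] {μ : Measure Ω}

lemma exp_le_one_add_mul_exp (u : ℝ) : Real.exp u ≤ 1 + u * Real.exp u := by
  have h := Real.add_one_le_exp (-u)
  have h1 : Real.exp (-u) * Real.exp u = 1 := by rw [← Real.exp_add]; simp
  nlinarith [Real.exp_pos u]

/-- The minimum is at most the geometric mean `√x √y`, so the exponent is at most `η √y`, uniformly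
in `x`, while the prefactor keeps the small parameter `η / √x`. -/
lemma exp_div_sqrt_mul_min_le {η x y : ℝ} (hη : 0 ≤ η) (hx : 0 < x) (hy : 0 ≤ y) :
    Real.exp (η / √x * min y x) ≤ 1 + η / √x * (y * Real.exp (η * √y)) := by
  have hsx : 0 < √x := Real.sqrt_pos.2 hx
  have hmin : min y x ≤ √x * √y := by
    rcases le_total y x with h | h
    · rw [min_eq_left h]
      nlinarith [Real.mul_self_sqrt hy, Real.sqrt_le_sqrt h, Real.sqrt_nonneg y]
    · rw [min_eq_right h]
      nlinarith [Real.mul_self_sqrt hx.le, Real.sqrt_le_sqrt h]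
  have hle : η / √x * min y x ≤ η * √y := by
    calc η / √x * min y x ≤ η / √x * (√x * √y) := by gcongr
      _ = η * √y := by field_simp
  refine (exp_le_one_add_mul_exp _).trans ?_
  rw [mul_assoc]
  gcongr
  exact min_le_left _ _

lemma measurable_stoppedSum {X : ℕ → Ω → ℝ} {N : Ω → ℕ} (hX : ∀ k, Measurable (X k))
    (hN : Measurable N) : Measurable (stoppedSum X N) := by
  have h : Measurable fun p : ℕ × Ω => ∑ k ∈ Finset.range p.1, X k p.2 :=
    measurable_from_prod_countable_right fun n =>
      Finset.measurable_fun_sum (Finset.range n) fun k _ => hX k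
  exact h.comp (hN.prodMk measurable_id)

/-- Chernoff bound for sums of truncated variables, at the scale `√x`. -/
lemma measureReal_le_sum_min_le {X : ℕ → Ω → ℝ} (hX : ∀ k, Measurable (X k))
    (hindep : iIndepFun X μ) (hident : ∀ k, IdentDistrib (X k) (X 0) μ μ)
    (hX0 : ∀ᵐ ω ∂μ, 0 ≤ X 0 ω) {η : ℝ} (hη : 0 ≤ η)
    (hint : Integrable (fun ω => X 0 ω * Real.exp (η * √(X 0 ω))) μ) {x : ℝ} (hx : 0 < x) (M : ℕ) :
    μ.real {ω | x ≤ ∑ k ∈ Finset.range M, min (X k ω) x} ≤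
      Real.exp (-η * √x + M * (η / √x * ∫ ω, X 0 ω * Real.exp (η * √(X 0 ω)) ∂μ)) := by
  have : IsProbabilityMeasure μ := hindep.isProbabilityMeasure
  set K := ∫ ω, X 0 ω * Real.exp (η * √(X 0 ω)) ∂μ
  set s := η / √x with hs
  have hs0 : 0 ≤ s := by positivity
  set Z : ℕ → Ω → ℝ := fun k ω => min (X k ω) x with hZ
  have hZm : ∀ k, Measurable (Z k) := fun k => (hX k).min measurable_const
  have hZindep : iIndepFun Z μ :=
    hindep.comp (fun _ y => min y x) fun _ => measurable_id.min measurable_const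
  have hZi : ∀ k, Integrable (fun ω => Real.exp (s * Z k ω)) μ := by
    intro k
    -- Truncation makes the exponential moment finite although `X k` itself may have none.
    refine Integrable.of_bound (C := Real.exp (s * x)) (by fun_prop) (ae_of_all _ fun ω => ?_)
    rw [Real.norm_of_nonneg (Real.exp_pos _).le]
    gcongr
    exact min_le_right _ _
  have hmgf : ∀ k, mgf (Z k) μ s ≤ Real.exp (s * K) := by
    intro k
    have hk : mgf (Z k) μ s = mgf (Z 0) μ s :=
      mgf_congr_of_identDistrib _ _
        ((hident k).comp (u := fun y => min y x) (measurable_id.min measurable_const)) s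
    rw [hk]
    calc mgf (Z 0) μ s ≤ ∫ ω, (1 + s * (X 0 ω * Real.exp (η * √(X 0 ω)))) ∂μ := by
          refine integral_mono_ae (hZi 0) ((integrable_const _).add (hint.const_mul _)) ?_
          filter_upwards [hX0] with ω hω using exp_div_sqrt_mul_min_le hη hx hω
      _ = 1 + s * K := by
          rw [integral_add (integrable_const _) (hint.const_mul _), integral_const_mul]
          simp [K]
      _ ≤ _ := by linarith [Real.add_one_le_exp (s * K)]
  have hch := measure_ge_le_exp_mul_mgf (μ := μ) (X := ∑ k ∈ Finset.range M, Z k) x hs0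
    (hZindep.integrable_exp_mul_sum hZm fun k _ => hZi k)
  rw [hZindep.mgf_sum hZm] at hch
  simp only [Finset.sum_apply] at hch
  refine hch.trans ?_
  have hsx : -s * x = -η * √x := by
    rw [hs]; field_simp; rw [Real.sq_sqrt hx.le]
  calc _ ≤ Real.exp (-s * x) * ∏ k ∈ Finset.range M, Real.exp (s * K) := by
        gcongr with k
        · exact fun _ _ => mgf_nonneg
        · exact hmgf k
    _ = _ := by
        rw [Finset.prod_const, Finset.card_range, ← Real.exp_nat_mul, ← Real.exp_add, hsx]

/-- Off the first two events truncation changes nothing, and nonnegativity lets the sum be extended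
from `N` to `M` terms. -/
lemma measureReal_lt_stoppedSum_le [IsProbabilityMeasure μ] {X : ℕ → Ω → ℝ} {N : Ω → ℕ}
    (hident : ∀ k, IdentDistrib (X k) (X 0) μ μ) (hX0 : ∀ᵐ ω ∂μ, 0 ≤ X 0 ω) (x : ℝ) (M : ℕ) :
    μ.real {ω | x < stoppedSum X N ω} ≤ μ.real {ω | M < N ω} + M * μ.real {ω | x < X 0 ω} +
      μ.real {ω | x ≤ ∑ k ∈ Finset.range M, min (X k ω) x} := by
  have hpos : ∀ᵐ ω ∂μ, ∀ k, 0 ≤ X k ω :=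
    ae_all_iff.2 fun k => ((hident k).symm.ae_mem_snd measurableSet_Ici hX0)
  have hsub : {ω | x < stoppedSum X N ω} ≤ᵐ[μ] (({ω | M < N ω} ∪
      ⋃ k ∈ Finset.range M, {ω | x < X k ω}) ∪
      {ω | x ≤ ∑ k ∈ Finset.range M, min (X k ω) x} : Set Ω) := by
    filter_upwards [hpos] with ω hω (hx : x < stoppedSum X N ω)
    by_cases h1 : M < N ω
    · exact Or.inl (Or.inl h1)
    by_cases h2 : ∃ k ∈ Finset.range M, x < X k ω
    · obtain ⟨k, hk, hkx⟩ := h2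
      exact Or.inl (Or.inr (Set.mem_biUnion hk hkx))
    push Not at h1 h2
    refine Or.inr ?_
    change x ≤ ∑ k ∈ Finset.range M, min (X k ω) x
    rw [Finset.sum_congr rfl fun k hk => min_eq_left (h2 k hk)]
    exact hx.le.trans (Finset.sum_le_sum_of_subset_of_nonneg (Finset.range_mono h1)
      fun k _ _ => hω k)
  have hmono : μ.real {ω | x < stoppedSum X N ω} ≤ μ.real (({ω | M < N ω} ∪
      ⋃ k ∈ Finset.range M, {ω | x < X k ω}) ∪
      {ω | x ≤ ∑ k ∈ Finset.range M, min (X k ω) x} : Set Ω) :=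
    ENNReal.toReal_mono (measure_ne_top _ _) (measure_mono_ae hsub)
  have hsum : μ.real (⋃ k ∈ Finset.range M, {ω | x < X k ω}) ≤ M * μ.real {ω | x < X 0 ω} := by
    refine (measureReal_biUnion_finset_le _ _).trans (le_of_eq ?_)
    have hk : ∀ k, μ.real {ω | x < X k ω} = μ.real {ω | x < X 0 ω} := fun k =>
      congrArg ENNReal.toReal ((hident k).measure_mem_eq measurableSet_Ioi)
    simp [hk]
  refine hmono.trans ((measureReal_union_le _ _).trans ?_)
  gcongr
  refine (measureReal_union_le _ _).trans ?_
  gcongr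

theorem SqrtExpTail.stoppedSum {X : ℕ → Ω → ℝ} {N : Ω → ℕ} (hXm : ∀ k, Measurable (X k))
    (hindep : iIndepFun X μ) (hident : ∀ k, IdentDistrib (X k) (X 0) μ μ)
    (hX0 : ∀ᵐ ω ∂μ, 0 ≤ X 0 ω) (hX : SqrtExpTail (X 0) μ)
    (hN : SqrtExpTail (fun ω => (N ω : ℝ)) μ) : SqrtExpTail (stoppedSum X N) μ := by
  have : IsProbabilityMeasure μ := hindep.isProbabilityMeasure
  obtain ⟨ε, hε, hexp⟩ := hX.exists_lintegral_exp_lt_top (hXm 0)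
  obtain ⟨C₁, a₁, ha₁, hX⟩ := hX
  obtain ⟨C₂, a₂, ha₂, hN⟩ := hN
  -- Half of the exponent `ε` is spent on absorbing the factor `X 0`.
  have hint : Integrable (fun ω => X 0 ω * Real.exp (ε / 2 * √(X 0 ω))) μ := by
    have hi : Integrable (fun ω => Real.exp (ε * √(X 0 ω))) μ := by
      have := hXm 0
      refine ⟨by fun_prop, ?_⟩
      rwa [hasFiniteIntegral_iff_ofReal (ae_of_all _ fun _ => (Real.exp_pos _).le)]
    refine (hi.const_mul (2 / (ε / 2) ^ 2)).mono' (by have := hXm 0; fun_prop) ?_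
    filter_upwards [hX0] with ω hω
    rw [Real.norm_of_nonneg (by positivity)]
    calc _ ≤ 2 / (ε / 2) ^ 2 * Real.exp (ε / 2 * √(X 0 ω)) * Real.exp (ε / 2 * √(X 0 ω)) := by
          gcongr
          exact le_mul_exp_sqrt (by positivity) hω
      _ = _ := by rw [mul_assoc, ← Real.exp_add]; ring_nf
  set K := ∫ ω, X 0 ω * Real.exp (ε / 2 * √(X 0 ω)) ∂μ with hK
  have hK0 : 0 ≤ K := integral_nonneg_of_ae (by
    filter_upwards [hX0] with ω hω
    exact mul_nonneg hω (Real.exp_pos _).le)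
  -- With `M ≤ x / L` one gets `M * K ≤ x / 2`, so the Chernoff exponent keeps half of `-(ε / 2) *
  -- √x`; the `+ 1` keeps `L` positive if `K = 0`.
  set L := 2 * (K + 1) with hL
  have hL0 : 0 < L := by positivity
  have hC₁ : 0 ≤ C₁ := by
    have := measureReal_nonneg.trans (hX 0 le_rfl)
    simpa using this
  have hC₂ : 0 ≤ C₂ := by
    have := measureReal_nonneg.trans (hN 0 le_rfl)
    simpa using this
  -- The rates come from `N > x / L`, from one large increment (half of `a₁` absorbs the factor
  -- `M`), and from the truncated sum.
  set a := min (a₂ / √L) (min (a₁ / 2) (ε / 4)) with ha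
  have ha0 : 0 < a := by positivity
  refine SqrtExpTail.of_eventually (C := C₂ + C₁ * (2 / (a₁ / 2) ^ 2) / L + 1) ha0 ?_
  filter_upwards [eventually_gt_atTop 0] with x hx
  have hsx : 0 < √x := Real.sqrt_pos.2 hx
  set M := ⌊x / L⌋₊ with hM
  have hMx : (M : ℝ) ≤ x / L := Nat.floor_le (by positivity)
  have hexp_le : ∀ b, a ≤ b → Real.exp (-b * √x) ≤ Real.exp (-a * √x) := fun b hb => by
    gcongr
  have h1 : μ.real {ω | M < N ω} ≤ C₂ * Real.exp (-a * √x) := by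
    have heq : {ω | M < N ω} = {ω | x / L < (N ω : ℝ)} := by
      ext ω
      exact Nat.floor_lt (by positivity)
    rw [heq]
    refine (hN _ (by positivity)).trans (mul_le_mul_of_nonneg_left (Real.exp_le_exp.2 ?_) hC₂)
    rw [Real.sqrt_div hx.le, neg_mul, neg_mul, neg_le_neg_iff]
    calc a * √x ≤ a₂ / √L * √x := by gcongr; exact min_le_left _ _
      _ = a₂ * (√x / √L) := by ring
  have h2 : M * μ.real {ω | x < X 0 ω} ≤ C₁ * (2 / (a₁ / 2) ^ 2) / L * Real.exp (-a * √x) := by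
    calc M * μ.real {ω | x < X 0 ω} ≤ x / L * (C₁ * Real.exp (-a₁ * √x)) := by
          gcongr
          exact hX x hx.le
      _ ≤ (2 / (a₁ / 2) ^ 2 * Real.exp (a₁ / 2 * √x)) / L * (C₁ * Real.exp (-a₁ * √x)) := by
          gcongr
          exact le_mul_exp_sqrt (by positivity) hx.le
      _ = C₁ * (2 / (a₁ / 2) ^ 2) / L * (Real.exp (a₁ / 2 * √x) * Real.exp (-a₁ * √x)) := by ring
      _ = C₁ * (2 / (a₁ / 2) ^ 2) / L * Real.exp (-(a₁ / 2) * √x) := by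
          rw [← Real.exp_add]; ring_nf
      _ ≤ _ := by
          gcongr
          exact (min_le_right _ _).trans (min_le_left _ _)
  have h3 : μ.real {ω | x ≤ ∑ k ∈ Finset.range M, min (X k ω) x} ≤ Real.exp (-a * √x) := by
    refine (measureReal_le_sum_min_le hXm hindep hident hX0 (by positivity) hint hx M).trans ?_
    refine le_trans ?_ (hexp_le (ε / 4) ((min_le_right _ _).trans (min_le_right _ _)))
    rw [Real.exp_le_exp]
    have hMK : M * K ≤ x / 2 := by
      calc M * K ≤ x / L * (K + 1) := by gcongr; linarith
        _ = x / 2 := by rw [hL]; field_simp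
    calc -(ε / 2) * √x + M * (ε / 2 / √x * K) = -(ε / 2) * √x + ε / 2 / √x * (M * K) := by ring
      _ ≤ -(ε / 2) * √x + ε / 2 / √x * (x / 2) := by gcongr
      _ = -(ε / 4) * √x := by
        field_simp
        rw [Real.sq_sqrt hx.le]
        ring
  calc _ ≤ _ := measureReal_lt_stoppedSum_le hident hX0 x M
    _ ≤ C₂ * Real.exp (-a * √x) + C₁ * (2 / (a₁ / 2) ^ 2) / L * Real.exp (-a * √x) +
        Real.exp (-a * √x) := by gcongr
    _ = _ := by ring

end StoppedSumTail

/-! ### From natural scales to tail bounds. -/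

section NaturalScales

variable {Ω : Type*} [MeasurableSpace Ω] {μ : Measure Ω} {Y : Ω → ℝ}

lemma exists_pos_eventually_le_of_liminfAtTop_pos {f : ℝ → ℝ} (h : 0 < liminfAtTop f) :
    ∃ c : ℝ, 0 < c ∧ ∀ᶠ x in atTop, c ≤ f x := by
  obtain ⟨c, hc0, hc⟩ := EReal.lt_iff_exists_real_btwn.1 h
  refine ⟨c, by exact_mod_cast hc0, ?_⟩
  filter_upwards [eventually_lt_of_lt_liminf hc] with x hx
  exact_mod_cast hx.le

/-- As the limit inferior is `1`, the hazard eventually exceeds `h x / 2`; any constant below `1`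
would serve. -/
lemma eventually_measureReal_le_of_mem_naturalScales [IsProbabilityMeasure μ] {h : ℝ → ℝ}
    (hh : h ∈ naturalScales Y μ) :
    ∀ᶠ x in atTop, μ.real {ω | x < Y ω} ≤ Real.exp (-(h x / 2)) := by
  obtain ⟨-, -, -, htop, hlim⟩ := hh
  have hhalf : ((1 / 2 : ℝ) : EReal) < liminf (fun x => hazard Y μ x / (h x : EReal)) atTop := by
    rw [hlim]; exact_mod_cast (by norm_num : (1 / 2 : ℝ) < 1)
  filter_upwards [eventually_lt_of_lt_liminf hhalf, htop.eventually_gt_atTop 0] with x hx hpos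
  rw [EReal.lt_div_iff (by exact_mod_cast hpos) (EReal.coe_ne_top _), hazard,
    ← EReal.coe_mul, EReal.lt_neg_comm, ← EReal.coe_neg] at hx
  have hlt : μ {ω | x < Y ω} ≤ ENNReal.ofReal (Real.exp (-(h x / 2))) := by
    rw [← ENNReal.log_le_log_iff, ENNReal.log_ofReal_of_pos (Real.exp_pos _), Real.log_exp]
    refine hx.le.trans (le_of_eq ?_)
    congr 1
    ring
  exact ENNReal.toReal_le_of_le_ofReal (Real.exp_pos _).le hlt

lemma SqrtExpTail.of_mem_naturalScales [IsProbabilityMeasure μ] {h : ℝ → ℝ}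
    (hh : h ∈ naturalScales Y μ) {c : ℝ} (hc : 0 < c) (hle : ∀ᶠ x in atTop, c * √x ≤ h x) :
    SqrtExpTail Y μ := by
  refine .of_eventually (C := 1) (a := c / 2) (by positivity) ?_
  filter_upwards [eventually_measureReal_le_of_mem_naturalScales hh, hle] with x hx hcx
  refine hx.trans ?_
  rw [one_mul, Real.exp_le_exp]
  linarith

/-- A lower bound of order `√x` survives a rescaling of the argument. -/
lemma eventually_mul_sqrt_le_of_comp_mul {h : ℝ → ℝ} {b c : ℝ} (hb : 0 < b)
    (hle : ∀ᶠ x in atTop, c * √x ≤ h (b * x)) : ∀ᶠ x in atTop, c / √b * √x ≤ h x := by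
  have ht : Tendsto (fun x : ℝ => x / b) atTop atTop := tendsto_id.atTop_div_const hb
  filter_upwards [ht.eventually hle] with x hx
  rw [mul_div_cancel₀ _ hb.ne', Real.sqrt_div' _ hb.le] at hx
  calc c / √b * √x = c * (√x / √b) := by ring
    _ ≤ h x := hx

end NaturalScales

end StoppedSum

/-! ### The determinacy theorem. -/

theorem theorem2 {Ω : Type*} [MeasurableSpace Ω] (μ : Measure Ω) [IsProbabilityMeasure μ]
    (X : ℕ → Ω → ℝ) (N : Ω → ℕ)
    (hXmeas : ∀ k, Measurable (X k)) (hNmeas : Measurable N)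
    (hNpos : ∀ᵐ ω ∂μ, 1 ≤ N ω)
    (hXindep : iIndepFun X μ) (hXident : ∀ k, IdentDistrib (X k) (X 0) μ μ)
    (hNX : IndepFun N (fun ω k => X k ω) μ)
    (hXnonneg : ∀ᵐ ω ∂μ, 0 ≤ X 0 ω)
    (hXheavy : StoppedSum.HeavyTailed (X 0) μ)
    (hNheavy : StoppedSum.HeavyTailed (fun ω => (N ω : ℝ)) μ)
    (hcond :
      (∃ h_X ∈ StoppedSum.naturalScales (X 0) μ,
        0 < StoppedSum.liminfAtTop (fun x => h_X x / √x) ∧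
        ∃ h_N ∈ StoppedSum.naturalScales (fun ω => (N ω : ℝ)) μ,
          ∃ c₁ : ℝ, (∫ ω, X 0 ω ∂μ) < c₁ ∧
            0 < StoppedSum.liminfAtTop (fun x => h_N (c₁ * x) / h_X x)) ∨
      (∃ h_N ∈ StoppedSum.naturalScales (fun ω => (N ω : ℝ)) μ,
        0 < StoppedSum.liminfAtTop (fun x => h_N ((∫ ω, X 0 ω ∂μ) * x) / √x) ∧
        ∃ h_X ∈ StoppedSum.naturalScales (X 0) μ,
          0 < StoppedSum.liminfAtTop (fun x => h_X x / h_N ((∫ ω, X 0 ω ∂μ) * x)))) :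
    StoppedSum.StieltjesDeterminate (StoppedSum.stoppedSum X N) μ := by
  have hmean : 0 ≤ ∫ ω, X 0 ω ∂μ := integral_nonneg_of_ae hXnonneg
  have htails : StoppedSum.SqrtExpTail (X 0) μ ∧
      StoppedSum.SqrtExpTail (fun ω => (N ω : ℝ)) μ := by
    rcases hcond with ⟨hX, hXs, hXroot, hN, hNs, b, hb, hNX⟩ | ⟨hN, hNs, hNroot, hX, hXs, hXN⟩
    · obtain ⟨c, hc, hXroot⟩ := StoppedSum.exists_pos_eventually_le_of_liminfAtTop_pos hXroot
      obtain ⟨d, hd, hNX⟩ := StoppedSum.exists_pos_eventually_le_of_liminfAtTop_pos hNX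
      have hb0 : 0 < b := hmean.trans_lt hb
      have hXle : ∀ᶠ x in atTop, c * √x ≤ hX x := by
        filter_upwards [hXroot, eventually_gt_atTop 0] with x hx hx0
        rwa [le_div_iff₀ (Real.sqrt_pos.2 hx0)] at hx
      have hNle : ∀ᶠ x in atTop, d * c * √x ≤ hN (b * x) := by
        filter_upwards [hXle, hNX, hXs.2.2.2.1.eventually_gt_atTop 0] with x h1 h2 h3
        rw [le_div_iff₀ h3] at h2
        nlinarith
      exact ⟨.of_mem_naturalScales hXs hc hXle, .of_mem_naturalScales hNs (by positivity)
        (StoppedSum.eventually_mul_sqrt_le_of_comp_mul hb0 hNle)⟩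
    · obtain ⟨c, hc, hNroot⟩ := StoppedSum.exists_pos_eventually_le_of_liminfAtTop_pos hNroot
      obtain ⟨d, hd, hXN⟩ := StoppedSum.exists_pos_eventually_le_of_liminfAtTop_pos hXN
      -- The integral would be `0` if `X 0` vanished almost surely or, by convention, if it were not
      -- integrable. Both are excluded: `h_N 0 = 0` would make the ratio with `√x` vanish
      -- identically.
      have hb0 : 0 < ∫ ω, X 0 ω ∂μ := by
        refine hmean.lt_of_ne fun h => ?_
        obtain ⟨x, hx⟩ := hNroot.exists
        rw [← h, zero_mul, hNs.2.2.1, zero_div] at hx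
        exact hc.not_ge hx
      have hNle : ∀ᶠ x in atTop, c * √x ≤ hN ((∫ ω, X 0 ω ∂μ) * x) := by
        filter_upwards [hNroot, eventually_gt_atTop 0] with x hx hx0
        rwa [le_div_iff₀ (Real.sqrt_pos.2 hx0)] at hx
      have hXle : ∀ᶠ x in atTop, d * c * √x ≤ hX x := by
        filter_upwards [hNle, hXN, eventually_gt_atTop 0] with x h1 h2 h3
        have h4 : 0 < hN ((∫ ω, X 0 ω ∂μ) * x) :=
          lt_of_lt_of_le (mul_pos hc (Real.sqrt_pos.2 h3)) h1
        rw [le_div_iff₀ h4] at h2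
        nlinarith
      exact ⟨.of_mem_naturalScales hXs (by positivity) hXle, .of_mem_naturalScales hNs
        (by positivity) (StoppedSum.eventually_mul_sqrt_le_of_comp_mul hb0 hNle)⟩
  have hpos : ∀ᵐ ω ∂μ, ∀ k, 0 ≤ X k ω :=
    ae_all_iff.2 fun k => ((hXident k).symm.ae_mem_snd measurableSet_Ici hXnonneg)
  refine (htails.1.stoppedSum hXmeas hXindep hXident hXnonneg htails.2).stieltjesDeterminate
    (StoppedSum.measurable_stoppedSum hXmeas hNmeas) ?_
  filter_upwards [hpos] with ω hω using Finset.sum_nonneg fun k _ => hω k
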